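/- For $\omega\in\mathbb{R}^3$ let $\hat\omega\in\mathbb{R}^{3\times 3}$ be the skew-symmetric matrix with $\hat\omega y=\omega\times y$ for all $y\in\mathbb{R}^3$, let $(\cdot)^\vee$ be the inverse of $\omega\mapsto\hat\omega$, and let $\mathrm{skew}(A)=\tfrac12(A-A^T)$. Let $J\in\mathbb{R}^{3\times3}$ be symmetric positive definite (the inertia matrix), let $K_\omega\in\mathbb{R}^{3\times3}$ be symmetric positive definite, and let $K_R\in\mathbb{R}^{3\times3}$ be symmetric with $\mathrm{tr}(K_R)I_3-K_R$ positive definite. Let $t\mapsto(R_p(t),\omega_p(t))\in \mathrm{SO}(3)\times\mathbb{R}^3$, $t\ge 0$, be a reference such that $\dot R_p(t)=R_p(t)\hat\omega_p(t)$ for all $t\ge0$ and $\omega_p$ is continuously differentiable and bounded on $[0,\infty)$. Consider on $\mathrm{SO}(3)\times\mathbb{R}^3$ the time-varying system $$\dot R_e=R_eR_p\hat e_\omega R_p^T,\qquad J\dot e_\omega=-R_p^Te_R-K_\omega e_\omega-\hat e_\omega Je_\omega-\hat e_\omega J\omega_p,\qquad e_R:=\mathrm{skew}(K_RR_e)^\vee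 .$$ Put $V_R(R_e,e_\omega):=\tfrac12e_\omega^TJe_\omega+\tfrac12\mathrm{tr}\big(K_R(I_3-R_e)\big)$ and $\ell_R:=\lambda_{\min}(\mathrm{tr}(K_R)I_3-K_R)$. Then $(R_e,e_\omega)=(I_3,0)$ is a uniformly asymptotically stable equilibrium point: it is an equilibrium; it is Lyapunov stable uniformly in the initial time $t_0\ge0$; and there is a neighbourhood of it from which all maximal solutions exist on $[t_0,\infty)$ and converge to $(I_3,0)$ uniformly in $t_0\ge0$ and in the initial state. Moreover its basin of attraction contains $$S_a=\{(R_e,e_\omega)\in\mathrm{SO}(3)\times\mathbb{R}^3:\ V_R(R_e,e_\omega)<\ell_R\},$$ that is, for every initial state in $S_a$ and every $t_0\ge 0$ all maximal solutions exist on $[t_0,\infty)$ and converge to $(I_3,0)$, the convergence being uniform in $t_0\ge0$ and locally uniform in the initial state. -/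

import Mathlib

open Set Filter Topology Matrix

/-! ### Time-varying differential equations on a subset of a topological vector space -/

section Stability

variable {E : Type*} [AddCommGroup E] [Module ℝ E] [TopologicalSpace E]
  [ContinuousSMul ℝ E] [IsTopologicalAddGroup E]

/-- `x` solves `ẋ = f t x` on the time interval `I` and stays in the state space `M`. -/
def IsSolutionOn (M : Set E) (f : ℝ → E → E) (I : Set ℝ) (x : ℝ → E) : Prop :=
  ∀ t ∈ I, x t ∈ M ∧ HasDerivWithinAt x (f t (x t)) I t

/-- Solutions from `x₀` at time `t₀` exist, and all maximal ones are complete: there is a solution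
on `[t₀, ∞)`, and every solution on some `[t₀, b)` extends to a solution on `[t₀, ∞)`. -/
def ForwardComplete (M : Set E) (f : ℝ → E → E) (t₀ : ℝ) (x₀ : E) : Prop :=
  (∃ x : ℝ → E, IsSolutionOn M f (Ici t₀) x ∧ x t₀ = x₀) ∧
  ∀ b : ℝ, t₀ < b → ∀ y : ℝ → E, IsSolutionOn M f (Ico t₀ b) y → y t₀ = x₀ →
    ∃ x : ℝ → E, IsSolutionOn M f (Ici t₀) x ∧ EqOn x y (Ico t₀ b)

/-- `p` is an equilibrium point of `ẋ = f t x`, `t ≥ 0`. -/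
def IsEquilibriumPoint (M : Set E) (f : ℝ → E → E) (p : E) : Prop :=
  p ∈ M ∧ ∀ t : ℝ, 0 ≤ t → f t p = 0

/-- Lyapunov stability of `p`, uniform in the initial time `t₀ ≥ 0`. The neighbourhoods `U`, `W`
play the role of the `ε`- and `δ`-balls around `p`. -/
def UniformlyStable (M : Set E) (f : ℝ → E → E) (p : E) : Prop :=
  ∀ U ∈ 𝓝 p, ∃ W ∈ 𝓝 p, ∀ t₀ : ℝ, 0 ≤ t₀ → ∀ x₀ ∈ W ∩ M,
    ForwardComplete M f t₀ x₀ ∧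
    ∀ x : ℝ → E, IsSolutionOn M f (Ici t₀) x → x t₀ = x₀ → ∀ t : ℝ, t₀ ≤ t → x t ∈ U

/-- All solutions starting in `S ∩ M` are complete and converge to `p`, uniformly with respect to
the initial time `t₀ ≥ 0` and the initial state in `S ∩ M`. -/
def UniformlyAttracts (M : Set E) (f : ℝ → E → E) (p : E) (S : Set E) : Prop :=
  (∀ t₀ : ℝ, 0 ≤ t₀ → ∀ x₀ ∈ S ∩ M, ForwardComplete M f t₀ x₀) ∧
  ∀ U ∈ 𝓝 p, ∃ T : ℝ, 0 ≤ T ∧ ∀ t₀ : ℝ, 0 ≤ t₀ → ∀ x₀ ∈ S ∩ M,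
    ∀ x : ℝ → E, IsSolutionOn M f (Ici t₀) x → x t₀ = x₀ → ∀ t : ℝ, t₀ + T ≤ t → x t ∈ U

/-- Uniform asymptotic stability of the equilibrium point `p`. -/
def UniformlyAsymptoticallyStable (M : Set E) (f : ℝ → E → E) (p : E) : Prop :=
  IsEquilibriumPoint M f p ∧ UniformlyStable M f p ∧ ∃ S ∈ 𝓝 p, UniformlyAttracts M f p S

/-- The basin of attraction of `p`: the states from which all solutions are complete and converge
to `p`, the convergence being uniform in the initial time and locally uniform in the initial
state. -/
def uniformBasin (M : Set E) (f : ℝ → E → E) (p : E) : Set E :=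
  {x₀ | x₀ ∈ M ∧ ∃ S ∈ 𝓝 x₀, UniformlyAttracts M f p S}

end Stability

/-! ### Attitude error dynamics -/

/-- `ℝ^{3×3}`. -/
abbrev Mat3 : Type := Matrix (Fin 3) (Fin 3) ℝ

/-- `ℝ³`. -/
abbrev Vec3 : Type := Fin 3 → ℝ

/-- The group `SO(3)` as a set of matrices. -/
def SO3 : Set Mat3 := {R | R ∈ Matrix.specialOrthogonalGroup (Fin 3) ℝ}

/-- `TSO(3) = SO(3) × ℝ³`, inside `ℝ^{3×3} × ℝ³`. -/
def TSO3 : Set (Mat3 × Vec3) := {x | x.1 ∈ SO3}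

/-- The hat map: `hat w *ᵥ y` is the cross product of `w` and `y`. -/
def hat (w : Vec3) : Mat3 := !![0, -w 2, w 1; w 2, 0, -w 0; -w 1, w 0, 0]

/-- The inverse of the hat map, on skew-symmetric matrices. -/
def vee (S : Mat3) : Vec3 := ![S 2 1, S 0 2, S 1 0]

/-- The skew-symmetric part of a matrix. -/
noncomputable def skewPart (A : Mat3) : Mat3 := (1 / 2 : ℝ) • (A - Aᵀ)

/-- The navigation function `Ψ_K(R) = ½ tr(K (I - R))`. -/
noncomputable def navFun (K R : Mat3) : ℝ := (1 / 2) * (K * (1 - R)).trace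

/-- The attitude error vector `e_R = skew(K_R R_e)^∨`. -/
noncomputable def attErr (KR Re : Mat3) : Vec3 := vee (skewPart (KR * Re))

/-- The smallest eigenvalue of a (symmetric) matrix. -/
noncomputable def lambdaMin (A : Mat3) : ℝ := sInf (spectrum ℝ A)

/-- `ℓ_R = λ_min(tr(K_R) I - K_R)`. -/
noncomputable def levelR (KR : Mat3) : ℝ := lambdaMin (KR.trace • (1 : Mat3) - KR)

/-- The total error energy `V_R(R_e, e_ω) = ½ e_ωᵀ J e_ω + Ψ_{K_R}(R_e)`. -/
noncomputable def energyR (J KR : Mat3) (x : Mat3 × Vec3) : ℝ :=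
  (1 / 2) * (x.2 ⬝ᵥ J *ᵥ x.2) + navFun KR x.1

/-- The reference `(R_p, ω_p)` is feasible: it takes values in `TSO(3)`, `Ṙ_p = R_p ω̂_p` on
`[0, ∞)`, and `ω_p` is continuously differentiable and bounded on `[0, ∞)`. -/
structure IsFeasibleReference (Rp : ℝ → Mat3) (ωp : ℝ → Vec3) : Prop where
  mem : ∀ t : ℝ, 0 ≤ t → Rp t ∈ SO3
  kinematics : ∀ t : ℝ, 0 ≤ t → HasDerivWithinAt Rp (Rp t * hat (ωp t)) (Ici 0) t
  smooth : ContDiffOn ℝ 1 ωp (Ici 0)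
  bounded : ∃ C : ℝ, ∀ t : ℝ, 0 ≤ t → ‖ωp t‖ ≤ C

/-- The right-hand side of the attitude error dynamics
`Ṙ_e = R_e R_p ê_ω R_pᵀ`, `J ė_ω = -R_pᵀ e_R - K_ω e_ω - ê_ω J e_ω - ê_ω J ω_p`. -/
noncomputable def attErrField (J KR Kω : Mat3) (Rp : ℝ → Mat3) (ωp : ℝ → Vec3)
    (t : ℝ) (x : Mat3 × Vec3) : Mat3 × Vec3 :=
  (x.1 * Rp t * hat x.2 * (Rp t)ᵀ,
    J⁻¹ *ᵥ (-((Rp t)ᵀ *ᵥ attErr KR x.1) - Kω *ᵥ x.2 - hat x.2 *ᵥ (J *ᵥ x.2)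
      - hat x.2 *ᵥ (J *ᵥ ωp t)))

/-- The sublevel set `S_a = {(R_e, e_ω) ∈ TSO(3) : V_R(R_e, e_ω) < ℓ_R}`. -/
def sublevelA (J KR : Mat3) : Set (Mat3 × Vec3) :=
  {x | x ∈ TSO3 ∧ energyR J KR x < levelR KR}

/-! Along solutions the energy $V_R$ has derivative $-e_\omega^TK_\omega e_\omega$: the gyroscopic
terms do no work, and the $e_R$ torque cancels the derivative of the navigation function $\Psi$.
Energy sublevels are thus compact and forward invariant, which gives completeness of solutions and,
as $V_R$ vanishes only at $(I,0)$, uniform stability.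

This dissipation does not see $R_e$, and the field depends on time, so attraction comes from a
strict Lyapunov function instead of an invariance principle. The cross term $W=e_R\cdot
R_pJe_\omega$ satisfies $\dot W\le-\frac12|e_R|^2+b|e_\omega|^2$ on a sublevel
(`exists_crossTerm_deriv_le`), so for small $\varepsilon$ the sum $V_R+\varepsilon W$ decays at rate
at least $\kappa(|e_\omega|^2+|e_R|^2)$. Only bounds on the reference enter, hence uniformity in
$t_0$.

For $c<\ell_R$ this rate is bounded away from zero on $\{\delta\le V_R\le c\}$, because $I$ is the
only critical point of $\Psi$ below $\ell_R$. Indeed, let $R$ be the rotation of the unit quaternion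
$(a,q)$ and $G=\mathrm{tr}(K)I-K$. Then $\Psi(R)=q^TGq$ and $e_R\cdot q=a\,q^TGq$, so a critical
point with $q\ne0$ has $a=0$, $|q|=1$ and $\Psi\ge\lambda_{\min}(G)=\ell_R$. Therefore $V_R$ falls
below $\delta$ within a time depending only on $c$, $\delta$ and the bounds, and stays there. -/

/-! ### Global existence for equations with trapped solutions -/

section InvariantCompact

open Metric NNReal

variable {P E : Type*} [NormedAddCommGroup P] [NormedSpace ℝ P] [FiniteDimensional ℝ P]
  [NormedAddCommGroup E] [NormedSpace ℝ E] [FiniteDimensional ℝ E]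

/-- A `C¹` function on a product is Lipschitz in the second variable, uniformly for the first
variable in a ball, on every ball. -/
theorem ContDiff.exists_lipschitzOnWith_snd {F : Type*} [NormedAddCommGroup F] [NormedSpace ℝ F]
    {g : P × E → F} (hg : ContDiff ℝ 1 g) (ρ : ℝ) (x₀ : E) (a : ℝ) :
    ∃ K : ℝ≥0, ∀ p ∈ closedBall (0 : P) ρ,
      LipschitzOnWith K (fun x => g (p, x)) (closedBall x₀ a) := by
  have hcpt : IsCompact (closedBall (0 : P) ρ ×ˢ closedBall x₀ a) :=
    (isCompact_closedBall _ _).prod (isCompact_closedBall _ _)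
  obtain ⟨K, hK⟩ := (hg.locallyLipschitz.locallyLipschitzOn
    (s := closedBall (0 : P) ρ ×ˢ closedBall x₀ a)).exists_lipschitzOnWith_of_compact hcpt
  refine ⟨K, fun p hp x hx y hy => ?_⟩
  have := hK (mk_mem_prod hp hx) (mk_mem_prod hp hy)
  simpa [Prod.edist_eq] using this

/-- The bounded-field case of global existence: on every compact time interval, an equation whose
right-hand side is bounded and `C¹` in the state has a solution. -/
theorem exists_solution_Icc_of_bounded {g : P × E → E} (hg : ContDiff ℝ 1 g) {L : ℝ≥0}
    {p : ℝ → P} {ρ : ℝ} (hL : ∀ q ∈ closedBall (0 : P) ρ, ∀ x, ‖g (q, x)‖ ≤ L)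
    {t₀ T : ℝ} (hT : t₀ ≤ T) (hp : ContinuousOn p (Icc t₀ T))
    (hρ : ∀ t ∈ Icc t₀ T, p t ∈ closedBall (0 : P) ρ) (x₀ : E) :
    ∃ x : ℝ → E, x t₀ = x₀ ∧
      ∀ t ∈ Icc t₀ T, HasDerivWithinAt x (g (p t, x t)) (Icc t₀ T) t := by
  -- Speed bound times duration: with this radius one Picard–Lindelöf application covers the whole
  -- interval.
  set a : ℝ≥0 := L * Real.toNNReal (T - t₀) with ha
  obtain ⟨K, hK⟩ := hg.exists_lipschitzOnWith_snd ρ x₀ a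
  have hPL : IsPicardLindelof (fun t x => g (p t, x)) (⟨t₀, left_mem_Icc.2 hT⟩ : Icc t₀ T)
      x₀ a 0 L K :=
    { lipschitzOnWith := fun t ht => hK _ (hρ t ht)
      continuousOn := fun x _ => hg.continuous.comp_continuousOn (hp.prodMk continuousOn_const)
      norm_le := fun t ht x _ => hL _ (hρ t ht) x
      mul_max_le := by
        have : (a : ℝ) = L * (T - t₀) := by
          rw [ha, NNReal.coe_mul, Real.coe_toNNReal _ (sub_nonneg.2 hT)]
        simp [this, max_eq_left (sub_nonneg.2 hT)] }
  exact hPL.exists_eq_forall_mem_Icc_hasDerivWithinAt (mem_closedBall_self le_rfl)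

theorem HasDerivWithinAt.Ici_of_Icc {E : Type*} [NormedAddCommGroup E] [NormedSpace ℝ E]
    {x : ℝ → E} {v : E} {a b t : ℝ}
    (h : HasDerivWithinAt x v (Icc a b) t) (ht : t ∈ Ico a b) : HasDerivWithinAt x v (Ici t) t :=
  h.mono_of_mem_nhdsWithin <|
    mem_of_superset (Icc_mem_nhdsGE ht.2) (Icc_subset_Icc_left ht.1)

theorem eqOn_Icc_of_solutions {g : P × E → E} (hg : ContDiff ℝ 1 g) {p : ℝ → P} {ρ : ℝ}
    {t₀ T : ℝ} (hρ : ∀ t ∈ Icc t₀ T, p t ∈ closedBall (0 : P) ρ)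
    {C : Set E} (hC : Bornology.IsBounded C) {x y : ℝ → E} (hxy : x t₀ = y t₀)
    (hx : ∀ t ∈ Icc t₀ T, x t ∈ C ∧ HasDerivWithinAt x (g (p t, x t)) (Icc t₀ T) t)
    (hy : ∀ t ∈ Icc t₀ T, y t ∈ C ∧ HasDerivWithinAt y (g (p t, y t)) (Icc t₀ T) t) :
    EqOn x y (Icc t₀ T) := by
  obtain ⟨a, ha⟩ := hC.subset_closedBall 0
  obtain ⟨K, hK⟩ := hg.exists_lipschitzOnWith_snd ρ 0 a
  have hsub : Ico t₀ T ⊆ Icc t₀ T := Ico_subset_Icc_self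
  exact ODE_solution_unique_of_mem_Icc_right (v := fun t x => g (p t, x))
    (s := fun _ => closedBall 0 a) (K := K)
    (fun t ht => hK _ (hρ t (hsub ht)))
    (fun t ht => (hx t ht).2.continuousWithinAt)
    (fun t ht => (hx t (hsub ht)).2.Ici_of_Icc ht) (fun t ht => ha (hx t (hsub ht)).1)
    (fun t ht => (hy t ht).2.continuousWithinAt)
    (fun t ht => (hy t (hsub ht)).2.Ici_of_Icc ht) (fun t ht => ha (hy t (hsub ht)).1) hxy

/-- The set `C` traps every solution starting from `x₀` at time `t₀` of every equation
`ẋ = φ(x) f(t, x)` with `φ ≥ 0`. -/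
def TrapsRescaled (f : ℝ → E → E) (C : Set E) (t₀ : ℝ) (x₀ : E) : Prop :=
  ∀ φ : E → ℝ, (∀ x, 0 ≤ φ x) → ∀ T : ℝ, ∀ x : ℝ → E, x t₀ = x₀ →
    (∀ t ∈ Icc t₀ T, HasDerivWithinAt x (φ (x t) • f t (x t)) (Icc t₀ T) t) →
    ∀ t ∈ Icc t₀ T, x t ∈ C

theorem TrapsRescaled.mem {E : Type*} [NormedAddCommGroup E] [NormedSpace ℝ E]
    {f : ℝ → E → E} {C : Set E} {t₀ T : ℝ} {x₀ : E}
    (h : TrapsRescaled f C t₀ x₀) {x : ℝ → E} (hx₀ : x t₀ = x₀)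
    (hx : ∀ t ∈ Icc t₀ T, HasDerivWithinAt x (f t (x t)) (Icc t₀ T) t) :
    ∀ t ∈ Icc t₀ T, x t ∈ C :=
  h (fun _ => 1) (fun _ => zero_le_one) T x hx₀ (by simpa using hx)

/-- Multiply the field by a bump function equal to 1 on `C`. The cut-off field is bounded, so it has
a solution; the trap tolerates nonnegative rescalings, so this solution stays in `C`, where the
cutoff is invisible. -/
theorem TrapsRescaled.exists_solution_Icc {g : P × E → E} (hg : ContDiff ℝ 1 g) {p : ℝ → P}
    {ρ : ℝ} {t₀ T : ℝ} (hT : t₀ ≤ T) (hp : ContinuousOn p (Icc t₀ T))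
    (hρ : ∀ t ∈ Icc t₀ T, p t ∈ closedBall (0 : P) ρ) {C : Set E} (hC : Bornology.IsBounded C)
    {x₀ : E} (h : TrapsRescaled (fun t x => g (p t, x)) C t₀ x₀) :
    ∃ x : ℝ → E, x t₀ = x₀ ∧
      ∀ t ∈ Icc t₀ T, x t ∈ C ∧ HasDerivWithinAt x (g (p t, x t)) (Icc t₀ T) t := by
  obtain ⟨a, ha⟩ := hC.subset_closedBall 0
  let φ : ContDiffBump (0 : E) := ⟨max a 1, max a 1 + 1, by positivity, by linarith⟩
  have hφ1 : ∀ x ∈ C, φ x = 1 := fun x hx =>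
    φ.one_of_mem_closedBall (closedBall_subset_closedBall (le_max_left _ _) (ha hx))
  have hG : ContDiff ℝ 1 (fun q : P × E => φ q.2 • g q) :=
    (φ.contDiff.comp contDiff_snd).smul hg
  obtain ⟨L, hL⟩ := ((isCompact_closedBall (0 : P) ρ).prod
    (isCompact_closedBall (0 : E) φ.rOut)).exists_bound_of_continuousOn hG.continuous.continuousOn
  have hL' : ∀ q ∈ closedBall (0 : P) ρ, ∀ x, ‖φ x • g (q, x)‖ ≤ Real.toNNReal L := by
    intro q hq x
    by_cases hx : x ∈ closedBall (0 : E) φ.rOut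
    · exact (hL (q, x) (mk_mem_prod hq hx)).trans (Real.le_coe_toNNReal L)
    · rw [φ.zero_of_le_dist (not_le.1 (mt mem_closedBall.2 hx)).le]
      simp
  obtain ⟨x, hx₀, hx⟩ := exists_solution_Icc_of_bounded hG hL' hT hp hρ x₀
  have hmem := h φ (fun _ => φ.nonneg) T x hx₀ hx
  refine ⟨x, hx₀, fun t ht => ⟨hmem t ht, ?_⟩⟩
  simpa [hφ1 _ (hmem t ht)] using hx t ht

/-- Solutions trapped in a compact part `C` of the state space exist for all forward times, and
every local one extends to a global one. -/
theorem TrapsRescaled.forwardComplete {g : P × E → E} (hg : ContDiff ℝ 1 g) {p : ℝ → P}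
    {ρ : ℝ} {t₀ : ℝ} (hp : ContinuousOn p (Ici t₀))
    (hρ : ∀ t ∈ Ici t₀, p t ∈ closedBall (0 : P) ρ) {C M : Set E} (hC : Bornology.IsBounded C)
    (hCM : C ⊆ M) {x₀ : E} (h : TrapsRescaled (fun t x => g (p t, x)) C t₀ x₀) :
    ForwardComplete M (fun t x => g (p t, x)) t₀ x₀ := by
  have hsub : ∀ T : ℝ, Icc t₀ T ⊆ Ici t₀ := fun T => Icc_subset_Ici_self
  have hloc : ∀ n : ℕ, ∃ x : ℝ → E, x t₀ = x₀ ∧ ∀ t ∈ Icc t₀ (t₀ + n),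
      x t ∈ C ∧ HasDerivWithinAt x (g (p t, x t)) (Icc t₀ (t₀ + n)) t := fun n =>
    h.exists_solution_Icc hg (by simp) (hp.mono (hsub _)) (fun t ht => hρ t (hsub _ ht)) hC
  choose X hX₀ hX using hloc
  have huniq : ∀ (n : ℕ) (T : ℝ) (y : ℝ → E), T ≤ t₀ + n → y t₀ = x₀ →
      (∀ t ∈ Icc t₀ T, HasDerivWithinAt y (g (p t, y t)) (Icc t₀ T) t) →
      EqOn (X n) y (Icc t₀ T) := by
    intro n T y hn hy₀ hy
    have hss : Icc t₀ T ⊆ Icc t₀ (t₀ + n) := Icc_subset_Icc_right hn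
    exact eqOn_Icc_of_solutions hg (fun t ht => hρ t (hsub _ ht)) hC ((hX₀ n).trans hy₀.symm)
      (fun t ht => ⟨(hX n t (hss ht)).1, (hX n t (hss ht)).2.mono hss⟩)
      (fun t ht => ⟨h.mem hy₀ hy t ht, hy t ht⟩)
  have hcompat : ∀ m n : ℕ, m ≤ n → EqOn (X n) (X m) (Icc t₀ (t₀ + m)) := fun m n hmn =>
    huniq n _ (X m) (by gcongr) (hX₀ m) fun t ht => (hX m t ht).2
  -- The global solution is glued from the `X n`, which agree on overlaps by uniqueness.
  let N : ℝ → ℕ := fun t => ⌈t - t₀⌉₊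
  have hN : ∀ t, t ≤ t₀ + N t := fun t => by
    have := Nat.le_ceil (t - t₀)
    simp only [N]; linarith
  let x : ℝ → E := fun t => X (N t) t
  have hxX : ∀ n : ℕ, EqOn x (X n) (Icc t₀ (t₀ + n)) := by
    intro n t ht
    refine (hcompat (N t) n ?_ ⟨ht.1, hN t⟩).symm
    exact Nat.ceil_le.2 (by linarith [ht.2])
  have hxsol : IsSolutionOn M (fun t x => g (p t, x)) (Ici t₀) x := by
    intro t ht
    -- One extra unit puts `t` strictly before the right endpoint, so the compact interval is a
    -- neighbourhood of `t` within `Ici t₀`.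
    have htn : t < t₀ + (N t + 1 : ℕ) := by push_cast; linarith [hN t]
    have htI : t ∈ Icc t₀ (t₀ + (N t + 1 : ℕ)) := ⟨ht, htn.le⟩
    have hn := hX (N t + 1) t htI
    have hxt := hxX (N t + 1) htI
    refine ⟨hxt ▸ hCM hn.1, ?_⟩
    have hnhds : Icc t₀ (t₀ + (N t + 1 : ℕ)) ∈ 𝓝[Ici t₀] t := by
      rw [← Ici_inter_Iic]
      exact inter_mem self_mem_nhdsWithin (mem_nhdsWithin_of_mem_nhds (Iic_mem_nhds htn))
    have := hn.2.congr_of_mem (hxX (N t + 1)) htI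
    rw [← hxt] at this
    exact this.mono_of_mem_nhdsWithin hnhds
  have hx₀ : x t₀ = x₀ := hX₀ _
  refine ⟨⟨x, hxsol, hx₀⟩, fun b hb y hy hy₀ => ⟨x, hxsol, fun t ht => ?_⟩⟩
  have hss : Icc t₀ t ⊆ Ico t₀ b := Icc_subset_Ico_right ht.2
  exact huniq (N t) t y (hN t) hy₀ (fun s hs => (hy s (hss hs)).2.mono hss) ⟨ht.1, le_rfl⟩

end InvariantCompact

/-! ### Eigenvalue bounds, hat map and rotations -/

section MatrixAlgebra

open scoped MatrixOrder in
/-- The smallest eigenvalue bounds the quadratic form from below. -/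
theorem lambdaMin_mul_dotProduct_le {A : Mat3} (hA : A.IsHermitian) (v : Vec3) :
    lambdaMin A * (v ⬝ᵥ v) ≤ v ⬝ᵥ A *ᵥ v := by
  have hbdd : BddBelow (spectrum ℝ A) := by
    rw [hA.spectrum_real_eq_range_eigenvalues]
    exact (finite_range _).bddBelow
  have hle : algebraMap ℝ Mat3 (lambdaMin A) ≤ A :=
    (algebraMap_le_iff_le_spectrum (R := ℝ) (a := A) hA).2 fun x hx => csInf_le hbdd hx
  have := (Matrix.le_iff.1 hle).dotProduct_mulVec_nonneg v
  simp only [star_trivial, Matrix.sub_mulVec, dotProduct_sub, Algebra.algebraMap_eq_smul_one,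
    Matrix.smul_mulVec, Matrix.one_mulVec, dotProduct_smul, smul_eq_mul] at this
  linarith

theorem lambdaMin_pos {A : Mat3} (hA : A.PosDef) : 0 < lambdaMin A := by
  have hspec := hA.isHermitian.spectrum_real_eq_range_eigenvalues
  have hmem : lambdaMin A ∈ spectrum ℝ A := by
    refine Set.Nonempty.csInf_mem ?_ ?_ <;> rw [hspec]
    · exact range_nonempty _
    · exact finite_range _
  rw [hspec] at hmem
  obtain ⟨i, hi⟩ := hmem
  exact hi ▸ hA.eigenvalues_pos i

/-- Turns the derivative of the navigation function along a rotation into a pairing with $e_R$. -/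
theorem trace_mul_hat_skew (A : Mat3) (w : Vec3) :
    (A * hat w).trace = -2 * (vee (skewPart A) ⬝ᵥ w) := by
  simp [Matrix.trace, Matrix.mul_apply, Fin.sum_univ_three, dotProduct, hat, vee, skewPart]
  ring

theorem hat_zero : hat 0 = 0 := by
  ext i j; fin_cases i <;> fin_cases j <;> simp [hat]

theorem transpose_hat (w : Vec3) : (hat w)ᵀ = -hat w := by
  ext i j; fin_cases i <;> fin_cases j <;> simp [hat]

theorem dotProduct_hat_mulVec_self (w y : Vec3) : w ⬝ᵥ hat w *ᵥ y = 0 := by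
  simp [hat, dotProduct, Matrix.mulVec, Fin.sum_univ_three]
  ring

theorem SO3.mul_transpose {R : Mat3} (h : R ∈ SO3) : R * Rᵀ = 1 := by
  have h1 := (Matrix.mem_specialOrthogonalGroup_iff.1 h).1
  exact (Matrix.mem_orthogonalGroup_iff (Fin 3) ℝ).1 h1

theorem SO3.transpose_mul {R : Mat3} (h : R ∈ SO3) : Rᵀ * R = 1 :=
  mul_eq_one_comm.1 (SO3.mul_transpose h)

theorem SO3.det {R : Mat3} (h : R ∈ SO3) : R.det = 1 :=
  (Matrix.mem_specialOrthogonalGroup_iff.1 h).2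

theorem mem_SO3_iff {R : Mat3} : R ∈ SO3 ↔ R * Rᵀ = 1 ∧ R.det = 1 :=
  ⟨fun h => ⟨SO3.mul_transpose h, SO3.det h⟩, fun h => Matrix.mem_specialOrthogonalGroup_iff.2
    ⟨(Matrix.mem_orthogonalGroup_iff (Fin 3) ℝ).2 h.1, h.2⟩⟩

theorem SO3.adjugate {R : Mat3} (h : R ∈ SO3) : R.adjugate = Rᵀ := by
  have h1 : R.adjugate * R = 1 := by rw [Matrix.adjugate_mul, SO3.det h, one_smul]
  calc R.adjugate = R.adjugate * (R * Rᵀ) := by rw [SO3.mul_transpose h, mul_one]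
    _ = Rᵀ := by rw [← mul_assoc, h1, one_mul]

/-- Conjugating a hat matrix by a rotation. -/
theorem SO3.mul_hat_mul_transpose {R : Mat3} (h : R ∈ SO3) (w : Vec3) :
    R * hat w * Rᵀ = hat (R *ᵥ w) := by
  -- Entrywise, this says that each entry of `R` equals its cofactor, which is the compatibility of
  -- rotations with the cross product.
  have ha := SO3.adjugate h
  rw [Matrix.adjugate_fin_three] at ha
  have e := fun i j => congrFun (congrFun ha i) j
  have e00 := e 0 0; have e01 := e 0 1; have e02 := e 0 2
  have e10 := e 1 0; have e11 := e 1 1; have e12 := e 1 2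
  have e20 := e 2 0; have e21 := e 2 1; have e22 := e 2 2
  simp at e00 e01 e02 e10 e11 e12 e20 e21 e22
  ext i j
  fin_cases i <;> fin_cases j <;>
    simp [Matrix.mul_apply, Fin.sum_univ_three, hat, Matrix.mulVec, dotProduct]
  all_goals grind

/-! ### Unit quaternions and critical points of the navigation function -/

/-- The rotation matrix of the unit quaternion `(a, q)`. -/
def quatRot (a : ℝ) (q : Vec3) : Mat3 :=
  (a ^ 2 - q ⬝ᵥ q) • (1 : Mat3) + (2 : ℝ) • vecMulVec q q + (2 * a) • hat q

/-- The symmetric matrix which is `4 q qᵀ` when `R` is the rotation of the unit quaternion `q`. -/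
def quatGram (R : Mat3) : Matrix (Fin 4) (Fin 4) ℝ :=
  !![1 + R 0 0 + R 1 1 + R 2 2, R 2 1 - R 1 2, R 0 2 - R 2 0, R 1 0 - R 0 1;
     R 2 1 - R 1 2, 1 + R 0 0 - R 1 1 - R 2 2, R 0 1 + R 1 0, R 0 2 + R 2 0;
     R 0 2 - R 2 0, R 0 1 + R 1 0, 1 - R 0 0 + R 1 1 - R 2 2, R 1 2 + R 2 1;
     R 1 0 - R 0 1, R 0 2 + R 2 0, R 1 2 + R 2 1, 1 - R 0 0 - R 1 1 + R 2 2]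

/-- `quatGram R` has rank one. -/
theorem quatGram_mul_quatGram {R : Mat3} (h : R ∈ SO3) (i j k : Fin 4) :
    quatGram R i j * quatGram R k k = quatGram R i k * quatGram R j k := by
  have ha := SO3.adjugate h
  rw [Matrix.adjugate_fin_three] at ha
  have e := fun i j => congrFun (congrFun ha i) j
  have e00 := e 0 0; have e01 := e 0 1; have e02 := e 0 2
  have e10 := e 1 0; have e11 := e 1 1; have e12 := e 1 2
  have e20 := e 2 0; have e21 := e 2 1; have e22 := e 2 2
  have f := fun i j => congrFun (congrFun (SO3.mul_transpose h) i) j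
  have f00 := f 0 0; have f01 := f 0 1; have f02 := f 0 2
  have f11 := f 1 1; have f12 := f 1 2; have f22 := f 2 2
  have f' := fun i j => congrFun (congrFun (SO3.transpose_mul h) i) j
  have g00 := f' 0 0; have g01 := f' 0 1; have g02 := f' 0 2
  have g11 := f' 1 1; have g12 := f' 1 2; have g22 := f' 2 2
  simp at e00 e01 e02 e10 e11 e12 e20 e21 e22
  simp [Matrix.mul_apply, Fin.sum_univ_three] at f00 f01 f02 f11 f12 f22 g00 g01 g02 g11 g12 g22
  fin_cases i <;> fin_cases j <;> fin_cases k <;> simp [quatGram] <;> grind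

/-- The trace is 4, so some diagonal entry is positive; the corresponding column, suitably
normalized, is the vector `c` by the rank-one identity. -/
theorem exists_mul_eq_quatGram {R : Mat3} (h : R ∈ SO3) :
    ∃ c : Fin 4 → ℝ, ∀ i j, 4 * (c i * c j) = quatGram R i j := by
  have htr : quatGram R 0 0 + quatGram R 1 1 + quatGram R 2 2 + quatGram R 3 3 = 4 := by
    simp [quatGram]; ring
  obtain ⟨k, hk⟩ : ∃ k, 0 < quatGram R k k := by
    by_contra! hneg
    linarith [hneg 0, hneg 1, hneg 2, hneg 3]
  have hs : √(quatGram R k k) ^ 2 = quatGram R k k := Real.sq_sqrt hk.le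
  have hs0 : √(quatGram R k k) ≠ 0 := (Real.sqrt_pos.2 hk).ne'
  refine ⟨fun i => quatGram R i k / (2 * √(quatGram R k k)), fun i j => ?_⟩
  field_simp
  rw [hs]
  linear_combination -4 * quatGram_mul_quatGram h i j k

theorem quatRot_eq (a x y z : ℝ) : quatRot a ![x, y, z] =
    !![a ^ 2 + x ^ 2 - y ^ 2 - z ^ 2, 2 * (x * y - a * z), 2 * (x * z + a * y);
       2 * (x * y + a * z), a ^ 2 - x ^ 2 + y ^ 2 - z ^ 2, 2 * (y * z - a * x);
       2 * (x * z - a * y), 2 * (y * z + a * x), a ^ 2 - x ^ 2 - y ^ 2 + z ^ 2] := by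
  ext i j
  fin_cases i <;> fin_cases j <;>
    simp [quatRot, hat, dotProduct, Fin.sum_univ_three] <;> ring

/-- Every rotation comes from a unit quaternion. -/
theorem exists_quatRot {R : Mat3} (h : R ∈ SO3) :
    ∃ (a : ℝ) (q : Vec3), a ^ 2 + q ⬝ᵥ q = 1 ∧ R = quatRot a q := by
  obtain ⟨c, hc⟩ := exists_mul_eq_quatGram h
  have c00 := hc 0 0; have c01 := hc 0 1; have c02 := hc 0 2; have c03 := hc 0 3
  have c11 := hc 1 1; have c12 := hc 1 2; have c13 := hc 1 3
  have c22 := hc 2 2; have c23 := hc 2 3; have c33 := hc 3 3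
  simp [quatGram] at c00 c01 c02 c03 c11 c12 c13 c22 c23 c33
  refine ⟨c 0, ![c 1, c 2, c 3], ?_, ?_⟩
  · simp [dotProduct, Fin.sum_univ_three]
    linarith
  · rw [quatRot_eq]
    ext i j
    fin_cases i <;> fin_cases j <;> simp <;> linarith

/-- The hat part has zero trace against the symmetric `K`, and $a^2-|q|^2=1-2|q|^2$ leaves
$|q|^2\mathrm{tr}K-q^TKq$. -/
theorem navFun_quatRot {K : Mat3} (a : ℝ) (q : Vec3) (h : a ^ 2 + q ⬝ᵥ q = 1)
    (hK : K.IsSymm) : navFun K (quatRot a q) = q ⬝ᵥ (K.trace • (1 : Mat3) - K) *ᵥ q := by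
  have h01 := hK.apply 0 1; have h02 := hK.apply 0 2; have h12 := hK.apply 1 2
  simp [navFun, quatRot, hat, dotProduct, Fin.sum_univ_three, vecMulVec_apply, Matrix.trace,
    Matrix.mul_apply, Matrix.mulVec, Matrix.one_apply] at h ⊢
  grind

/-- Only the hat part of the rotation survives the pairing with `q`, whence the factor `a`. -/
theorem attErr_quatRot_dotProduct {K : Mat3} (a : ℝ) (q : Vec3) (hK : K.IsSymm) :
    attErr K (quatRot a q) ⬝ᵥ q = a * (q ⬝ᵥ (K.trace • (1 : Mat3) - K) *ᵥ q) := by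
  have h01 := hK.apply 0 1; have h02 := hK.apply 0 2; have h12 := hK.apply 1 2
  simp [attErr, vee, skewPart, quatRot, hat, dotProduct, Fin.sum_univ_three, vecMulVec_apply,
    Matrix.trace, Matrix.mul_apply, Matrix.mulVec, Matrix.one_apply]
  grind

theorem navFun_nonneg {K : Mat3} (hK : K.IsSymm) (hK' : (K.trace • (1 : Mat3) - K).PosDef)
    {R : Mat3} (hR : R ∈ SO3) : 0 ≤ navFun K R := by
  obtain ⟨a, q, h, rfl⟩ := exists_quatRot hR
  rw [navFun_quatRot a q h hK]
  simpa using hK'.posSemidef.dotProduct_mulVec_nonneg q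

theorem quatRot_eq_one {a : ℝ} {q : Vec3} (h : a ^ 2 + q ⬝ᵥ q = 1) (hq : q = 0) :
    quatRot a q = 1 := by
  subst hq
  simp only [dotProduct_zero, add_zero] at h
  simp [quatRot, h, hat_zero]

theorem eq_one_of_navFun_eq_zero {K : Mat3} (hK : K.IsSymm)
    (hK' : (K.trace • (1 : Mat3) - K).PosDef) {R : Mat3} (hR : R ∈ SO3)
    (h0 : navFun K R = 0) : R = 1 := by
  obtain ⟨a, q, h, rfl⟩ := exists_quatRot hR
  rw [navFun_quatRot a q h hK] at h0
  refine quatRot_eq_one h ?_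
  by_contra hq
  have := hK'.dotProduct_mulVec_pos hq
  simp only [star_trivial] at this
  linarith

/-- Below the level `levelR K`, the identity is the only critical point of the navigation
function. -/
theorem eq_one_of_attErr_eq_zero {K : Mat3} (hK : K.IsSymm)
    (hK' : (K.trace • (1 : Mat3) - K).PosDef) {R : Mat3} (hR : R ∈ SO3)
    (hlt : navFun K R < levelR K) (h0 : attErr K R = 0) : R = 1 := by
  obtain ⟨a, q, h, rfl⟩ := exists_quatRot hR
  rw [navFun_quatRot a q h hK] at hlt
  have hcrit := attErr_quatRot_dotProduct a q hK
  rw [h0, zero_dotProduct] at hcrit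
  refine quatRot_eq_one h ?_
  by_contra hq
  have hpos := hK'.dotProduct_mulVec_pos hq
  simp only [star_trivial] at hpos
  have ha : a = 0 := by
    rcases mul_eq_zero.1 hcrit.symm with ha | ha
    · exact ha
    · linarith
  -- With $a=0$ the rotation is a half turn and $|q|=1$, so its potential is at least `levelR K`.
  have hmin := lambdaMin_mul_dotProduct_le hK'.isHermitian q
  rw [show q ⬝ᵥ q = 1 by simpa [ha] using h, mul_one] at hmin
  exact absurd hlt (not_lt.2 hmin)

end MatrixAlgebra

/-! ### Derivatives of the energy and of the cross term -/

section Calculus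

attribute [local instance] Matrix.normedAddCommGroup Matrix.normedSpace

variable {s : Set ℝ} {t : ℝ}

theorem hasDerivWithinAt_mat3_iff {A : ℝ → Mat3} {A' : Mat3} :
    HasDerivWithinAt A A' s t ↔ ∀ i j, HasDerivWithinAt (fun τ => A τ i j) (A' i j) s t :=
  Iff.trans hasDerivWithinAt_pi (forall_congr' fun _ => hasDerivWithinAt_pi)

theorem HasDerivWithinAt.mat3_mul {A B : ℝ → Mat3} {A' B' : Mat3}
    (hA : HasDerivWithinAt A A' s t) (hB : HasDerivWithinAt B B' s t) :
    HasDerivWithinAt (fun τ => A τ * B τ) (A' * B t + A t * B') s t := by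
  rw [hasDerivWithinAt_mat3_iff] at *
  intro i j
  simp only [Matrix.add_apply, Matrix.mul_apply, ← Finset.sum_add_distrib]
  exact HasDerivWithinAt.fun_sum fun k _ => (hA i k).mul (hB k j)

theorem HasDerivWithinAt.mat3_transpose {A : ℝ → Mat3} {A' : Mat3}
    (hA : HasDerivWithinAt A A' s t) : HasDerivWithinAt (fun τ => (A τ)ᵀ) A'ᵀ s t := by
  rw [hasDerivWithinAt_mat3_iff] at *
  exact fun i j => hA j i

theorem HasDerivWithinAt.mat3_trace {A : ℝ → Mat3} {A' : Mat3}
    (hA : HasDerivWithinAt A A' s t) : HasDerivWithinAt (fun τ => (A τ).trace) A'.trace s t := by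
  rw [hasDerivWithinAt_mat3_iff] at hA
  exact HasDerivWithinAt.fun_sum fun i _ => hA i i

theorem HasDerivWithinAt.vec3_dotProduct {v w : ℝ → Vec3} {v' w' : Vec3}
    (hv : HasDerivWithinAt v v' s t) (hw : HasDerivWithinAt w w' s t) :
    HasDerivWithinAt (fun τ => v τ ⬝ᵥ w τ) (v' ⬝ᵥ w t + v t ⬝ᵥ w') s t := by
  rw [hasDerivWithinAt_pi] at hv hw
  simp only [dotProduct, ← Finset.sum_add_distrib]
  exact HasDerivWithinAt.fun_sum fun k _ => (hv k).mul (hw k)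

theorem HasDerivWithinAt.mat3_mulVec {A : ℝ → Mat3} {A' : Mat3} {v : ℝ → Vec3} {v' : Vec3}
    (hA : HasDerivWithinAt A A' s t) (hv : HasDerivWithinAt v v' s t) :
    HasDerivWithinAt (fun τ => A τ *ᵥ v τ) (A' *ᵥ v t + A t *ᵥ v') s t := by
  rw [hasDerivWithinAt_mat3_iff] at hA
  rw [hasDerivWithinAt_pi] at *
  intro i
  simp only [Pi.add_apply, Matrix.mulVec, dotProduct, ← Finset.sum_add_distrib]
  exact HasDerivWithinAt.fun_sum fun k _ => (hA i k).mul (hv k)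

theorem HasDerivWithinAt.attErr {K : Mat3} {A : ℝ → Mat3} {A' : Mat3}
    (hA : HasDerivWithinAt A A' s t) :
    HasDerivWithinAt (fun τ => attErr K (A τ)) (attErr K A') s t := by
  have h := (hasDerivWithinAt_const t s K).mat3_mul hA
  rw [Matrix.zero_mul, zero_add, hasDerivWithinAt_mat3_iff] at h
  rw [hasDerivWithinAt_pi]
  intro i
  fin_cases i
  · simpa [_root_.attErr, vee, skewPart, -Matrix.transpose_mul] using
      ((h 2 1).sub (h 1 2)).const_mul (1 / 2 : ℝ)
  · simpa [_root_.attErr, vee, skewPart, -Matrix.transpose_mul] using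
      ((h 0 2).sub (h 2 0)).const_mul (1 / 2 : ℝ)
  · simpa [_root_.attErr, vee, skewPart, -Matrix.transpose_mul] using
      ((h 1 0).sub (h 0 1)).const_mul (1 / 2 : ℝ)

theorem HasDerivWithinAt.prod_fst {E F : Type*} [NormedAddCommGroup E] [NormedSpace ℝ E]
    [NormedAddCommGroup F] [NormedSpace ℝ F] {x : ℝ → E × F} {v : E × F}
    (h : HasDerivWithinAt x v s t) : HasDerivWithinAt (fun τ => (x τ).1) v.1 s t :=
  (ContinuousLinearMap.fst ℝ E F).hasFDerivAt.comp_hasDerivWithinAt t h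

theorem HasDerivWithinAt.prod_snd {E F : Type*} [NormedAddCommGroup E] [NormedSpace ℝ E]
    [NormedAddCommGroup F] [NormedSpace ℝ F] {x : ℝ → E × F} {v : E × F}
    (h : HasDerivWithinAt x v s t) : HasDerivWithinAt (fun τ => (x τ).2) v.2 s t :=
  (ContinuousLinearMap.snd ℝ E F).hasFDerivAt.comp_hasDerivWithinAt t h

/-- Dissipation identity: along `ẋ = φ f(t, x)` the energy has derivative `-φ e_ωᵀ K_ω e_ω`. -/
theorem hasDerivWithinAt_energyR {J KR Kω : Mat3} (hJ : J.PosDef) {Rp : ℝ → Mat3} {ωp : ℝ → Vec3}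
    (hRp : Rp t ∈ SO3) {φ : ℝ} {x : ℝ → Mat3 × Vec3}
    (hx : HasDerivWithinAt x (φ • attErrField J KR Kω Rp ωp t (x t)) s t) :
    HasDerivWithinAt (fun τ => energyR J KR (x τ)) (-(φ * ((x t).2 ⬝ᵥ Kω *ᵥ (x t).2))) s t := by
  have hR := hx.prod_fst
  have he := hx.prod_snd
  have hJe := (hasDerivWithinAt_const t s J).mat3_mulVec he
  have hkin := (he.vec3_dotProduct hJe).const_mul (1 / 2 : ℝ)
  have hpot := ((hasDerivWithinAt_const t s KR).mat3_mul
    ((hasDerivWithinAt_const t s (1 : Mat3)).sub hR)).mat3_trace.const_mul (1 / 2 : ℝ)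
  refine (hkin.add hpot).congr_deriv ?_
  simp only [attErrField, Prod.smul_fst, Prod.smul_snd, Matrix.zero_mulVec, zero_add,
    Matrix.zero_mul, zero_sub, Matrix.mul_neg, Matrix.trace_neg, Matrix.mul_smul,
    Matrix.trace_smul, smul_eq_mul]
  set R := (x t).1
  set e := (x t).2
  have hJsymm : ∀ v w : Vec3, v ⬝ᵥ J *ᵥ w = w ⬝ᵥ J *ᵥ v := by
    intro v w
    have hT : Jᵀ = J := by simpa using hJ.isHermitian.eq
    rw [Matrix.dotProduct_mulVec, ← Matrix.mulVec_transpose, hT, dotProduct_comm]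
  have hJJ : J * J⁻¹ = 1 := Matrix.mul_nonsing_inv J (isUnit_iff_ne_zero.2 hJ.det_pos.ne')
  have htr : (KR * (R * Rp t * hat e * (Rp t)ᵀ)).trace = -2 * (attErr KR R ⬝ᵥ Rp t *ᵥ e) := by
    rw [show R * Rp t * hat e * (Rp t)ᵀ = R * (Rp t * hat e * (Rp t)ᵀ) by
      simp only [Matrix.mul_assoc], SO3.mul_hat_mul_transpose hRp, ← Matrix.mul_assoc,
      trace_mul_hat_skew]
    rfl
  have hadj : e ⬝ᵥ (Rp t)ᵀ *ᵥ attErr KR R = attErr KR R ⬝ᵥ Rp t *ᵥ e := by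
    rw [Matrix.dotProduct_mulVec, Matrix.vecMul_transpose, dotProduct_comm]
  rw [htr, hJsymm (φ • _) e, Matrix.mulVec_smul, Matrix.mulVec_mulVec, hJJ, Matrix.one_mulVec,
    dotProduct_smul, smul_eq_mul]
  -- Both gyroscopic terms are orthogonal to $e_\omega$, and the $e_R$ terms cancel.
  simp only [dotProduct_sub, dotProduct_neg, hadj, dotProduct_hat_mulVec_self]
  ring

/-- The cross term added to the energy to obtain strict decay. -/
noncomputable def crossTerm (J KR : Mat3) (Rp : ℝ → Mat3) (t : ℝ) (x : Mat3 × Vec3) : ℝ :=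
  attErr KR x.1 ⬝ᵥ Rp t *ᵥ (J *ᵥ x.2)

/-- The factors $R_p$ and $J$ in the cross term undo $R_p^T$ and $J^{-1}$ in the field, so the
attitude torque contributes exactly $-|e_R|^2$; every other term carries a factor $e_\omega$. -/
theorem hasDerivWithinAt_crossTerm {J KR Kω : Mat3} (hJ : J.PosDef) {Rp : ℝ → Mat3}
    {ωp : ℝ → Vec3} (hRp : Rp t ∈ SO3) (hRp' : HasDerivWithinAt Rp (Rp t * hat (ωp t)) s t)
    {x : ℝ → Mat3 × Vec3} (hx : HasDerivWithinAt x (attErrField J KR Kω Rp ωp t (x t)) s t) :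
    HasDerivWithinAt (fun τ => crossTerm J KR Rp τ (x τ))
      (-(attErr KR (x t).1 ⬝ᵥ attErr KR (x t).1)
        + attErr KR (x t).1 ⬝ᵥ ((Rp t * hat (ωp t)) *ᵥ (J *ᵥ (x t).2)
          - Rp t *ᵥ (Kω *ᵥ (x t).2 + hat (x t).2 *ᵥ (J *ᵥ (x t).2)
            + hat (x t).2 *ᵥ (J *ᵥ ωp t)))
        + attErr KR ((x t).1 * hat (Rp t *ᵥ (x t).2)) ⬝ᵥ Rp t *ᵥ (J *ᵥ (x t).2)) s t := by
  have hR := hx.prod_fst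
  have he := hx.prod_snd
  have hJe := (hasDerivWithinAt_const t s J).mat3_mulVec he
  refine ((hR.attErr (K := KR)).vec3_dotProduct (hRp'.mat3_mulVec hJe)).congr_deriv ?_
  have hJJ : J * J⁻¹ = 1 := Matrix.mul_nonsing_inv J (isUnit_iff_ne_zero.2 hJ.det_pos.ne')
  have hRR : ∀ v : Vec3, Rp t *ᵥ ((Rp t)ᵀ *ᵥ v) = v := fun v => by
    rw [Matrix.mulVec_mulVec, SO3.mul_transpose hRp, Matrix.one_mulVec]
  simp only [attErrField, Matrix.zero_mulVec, zero_add]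
  rw [show (x t).1 * Rp t * hat (x t).2 * (Rp t)ᵀ = (x t).1 * (Rp t * hat (x t).2 * (Rp t)ᵀ) by
    simp only [Matrix.mul_assoc], SO3.mul_hat_mul_transpose hRp, Matrix.mulVec_mulVec _ J, hJJ,
    Matrix.one_mulVec]
  simp only [Matrix.mulVec_sub, Matrix.mulVec_neg, Matrix.mulVec_add, hRR, dotProduct_add,
    dotProduct_sub, dotProduct_neg]
  ring

end Calculus

/-! ### Norm estimates, uniform over rotations -/

section Estimates

attribute [local instance] Matrix.normedAddCommGroup Matrix.normedSpace

/-- Vectors and matrices carry the entrywise sup norm; the 3 counts coordinates and is the source of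
the powers of 3 below. -/
theorem abs_dotProduct_le_vec3 (v w : Vec3) : |v ⬝ᵥ w| ≤ 3 * ‖v‖ * ‖w‖ := by
  refine (Finset.abs_sum_le_sum_abs _ _).trans ?_
  have : ∀ i ∈ Finset.univ, |v i * w i| ≤ ‖v‖ * ‖w‖ := fun i _ => by
    rw [abs_mul]
    exact mul_le_mul (norm_le_pi_norm v i) (norm_le_pi_norm w i) (abs_nonneg _) (norm_nonneg _)
  refine (Finset.sum_le_sum this).trans_eq ?_
  simp
  ring

theorem norm_mulVec_le_mat3 (A : Mat3) (v : Vec3) : ‖A *ᵥ v‖ ≤ 3 * ‖A‖ * ‖v‖ := by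
  refine (pi_norm_le_iff_of_nonneg (by positivity)).2 fun i => ?_
  refine (abs_dotProduct_le_vec3 (A i) v).trans ?_
  gcongr
  exact norm_le_pi_norm (f := fun i => A i) i

theorem norm_mul_le_mat3 (A B : Mat3) : ‖A * B‖ ≤ 3 * ‖A‖ * ‖B‖ := by
  refine (Matrix.norm_le_iff (by positivity)).2 fun i j => ?_
  rw [Matrix.mul_apply_eq_vecMul, Real.norm_eq_abs]
  refine (abs_dotProduct_le_vec3 (A i) (fun k => B k j)).trans ?_
  gcongr
  · exact norm_le_pi_norm (f := fun i => A i) i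
  · exact (pi_norm_le_iff_of_nonneg (norm_nonneg _)).2 fun k =>
      Matrix.norm_entry_le_entrywise_sup_norm B

theorem norm_hat_le (w : Vec3) : ‖hat w‖ ≤ ‖w‖ := by
  refine (Matrix.norm_le_iff (norm_nonneg _)).2 fun i j => ?_
  have h := fun k => norm_le_pi_norm w k
  simp only [Real.norm_eq_abs] at h
  fin_cases i <;> fin_cases j <;> simp [hat, h]

theorem norm_attErr_le (K A : Mat3) : ‖attErr K A‖ ≤ 3 * ‖K‖ * ‖A‖ := by
  refine le_trans ?_ (norm_mul_le_mat3 K A)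
  have h : ∀ i j, |(K * A) i j| ≤ ‖K * A‖ := fun i j =>
    Matrix.norm_entry_le_entrywise_sup_norm (K * A)
  have h2 : ∀ i j, |(1 / 2 : ℝ) * ((K * A) i j - (K * A) j i)| ≤ ‖K * A‖ := fun i j => by
    have h1 := abs_le.1 (h i j)
    have h1' := abs_le.1 (h j i)
    exact abs_le.2 ⟨by linarith, by linarith⟩
  refine (pi_norm_le_iff_of_nonneg (norm_nonneg _)).2 fun i => ?_
  fin_cases i
  · exact h2 2 1
  · exact h2 0 2
  · exact h2 1 0

theorem norm_le_one_of_mem_SO3 {R : Mat3} (h : R ∈ SO3) : ‖R‖ ≤ 1 :=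
  (Matrix.norm_le_iff zero_le_one).2 fun i j =>
    entry_norm_bound_of_unitary (Matrix.mem_specialOrthogonalGroup_iff.1 h).1 i j

theorem sq_norm_le_dotProduct (v : Vec3) : ‖v‖ ^ 2 ≤ v ⬝ᵥ v := by
  obtain ⟨i, hi⟩ : ∃ i, ‖v‖ = ‖v i‖ := by
    obtain ⟨i, -, hi⟩ := Finset.exists_mem_eq_sup' (Finset.univ_nonempty) (fun i => ‖v i‖₊)
    refine ⟨i, le_antisymm ?_ (norm_le_pi_norm v i)⟩
    refine (pi_norm_le_iff_of_nonneg (norm_nonneg _)).2 fun j => ?_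
    have : ‖v j‖₊ ≤ ‖v i‖₊ := hi ▸ Finset.le_sup' (fun i => ‖v i‖₊) (Finset.mem_univ j)
    exact this
  rw [hi, Real.norm_eq_abs, sq_abs, sq]
  exact Finset.single_le_sum (f := fun i => v i * v i) (fun j _ => mul_self_nonneg _)
    (Finset.mem_univ i)

theorem norm_SO3_mulVec_le {R : Mat3} (h : R ∈ SO3) (v : Vec3) : ‖R *ᵥ v‖ ≤ 3 * ‖v‖ := by
  refine (norm_mulVec_le_mat3 R v).trans ?_
  have := norm_le_one_of_mem_SO3 h
  have hv := norm_nonneg v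
  nlinarith

theorem norm_hat_mulVec_le (w v : Vec3) : ‖hat w *ᵥ v‖ ≤ 3 * ‖w‖ * ‖v‖ := by
  refine (norm_mulVec_le_mat3 _ v).trans ?_
  gcongr
  exact norm_hat_le w

/-- Upper bound for the derivative of the cross term, uniform over rotations and over bounded
angular velocities. -/
theorem exists_crossTerm_deriv_le (J KR Kω : Mat3) (Ω r : ℝ) (hΩ : 0 ≤ Ω) (hr : 0 ≤ r) :
    ∃ c : ℝ, 0 ≤ c ∧ ∀ Q ∈ SO3, ∀ R ∈ SO3, ∀ w e : Vec3, ‖w‖ ≤ Ω → ‖e‖ ≤ r →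
      -(attErr KR R ⬝ᵥ attErr KR R)
        + attErr KR R ⬝ᵥ ((Q * hat w) *ᵥ (J *ᵥ e)
          - Q *ᵥ (Kω *ᵥ e + hat e *ᵥ (J *ᵥ e) + hat e *ᵥ (J *ᵥ w)))
        + attErr KR (R * hat (Q *ᵥ e)) ⬝ᵥ Q *ᵥ (J *ᵥ e)
      ≤ -(1 / 2) * ‖attErr KR R‖ ^ 2 + c * ‖e‖ ^ 2 := by
  -- `c₁` bounds the bracket paired with $e_R$, which is linear in `‖e‖` once one factor is bounded
  -- by `r`; `c₂` bounds the term coming from $\dot e_R$, quadratic in `‖e‖`.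
  set c₁ : ℝ := 27 * ‖J‖ * Ω + 3 * (3 * ‖Kω‖ + 9 * ‖J‖ * r + 9 * ‖J‖ * Ω) with hc₁
  set c₂ : ℝ := 729 * ‖KR‖ * ‖J‖ with hc₂
  have hc₁0 : 0 ≤ c₁ := by positivity
  have hc₂0 : 0 ≤ c₂ := by positivity
  refine ⟨9 / 2 * c₁ ^ 2 + c₂, by positivity, fun Q hQ R hR w e hw he => ?_⟩
  have hJe : ‖J *ᵥ e‖ ≤ 3 * ‖J‖ * ‖e‖ := norm_mulVec_le_mat3 J e
  have hJw : ‖J *ᵥ w‖ ≤ 3 * ‖J‖ * Ω := (norm_mulVec_le_mat3 J w).trans (by gcongr)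
  have hQJe : ‖Q *ᵥ (J *ᵥ e)‖ ≤ 9 * ‖J‖ * ‖e‖ := (norm_SO3_mulVec_le hQ _).trans (by linarith)
  have hdrift : ‖(Q * hat w) *ᵥ (J *ᵥ e)‖ ≤ 27 * ‖J‖ * Ω * ‖e‖ := by
    rw [← Matrix.mulVec_mulVec]
    calc ‖Q *ᵥ (hat w *ᵥ (J *ᵥ e))‖ ≤ 3 * (3 * ‖w‖ * ‖J *ᵥ e‖) :=
          (norm_SO3_mulVec_le hQ _).trans (by gcongr; exact norm_hat_mulVec_le _ _)
      _ ≤ 3 * (3 * Ω * (3 * ‖J‖ * ‖e‖)) := by gcongr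
      _ = 27 * ‖J‖ * Ω * ‖e‖ := by ring
  have hgyro : ‖hat e *ᵥ (J *ᵥ e)‖ ≤ 9 * ‖J‖ * r * ‖e‖ := by
    calc ‖hat e *ᵥ (J *ᵥ e)‖ ≤ 3 * ‖e‖ * ‖J *ᵥ e‖ := norm_hat_mulVec_le _ _
      _ ≤ 3 * r * (3 * ‖J‖ * ‖e‖) := by gcongr
      _ = _ := by ring
  have hgyro' : ‖hat e *ᵥ (J *ᵥ w)‖ ≤ 9 * ‖J‖ * Ω * ‖e‖ := by
    calc ‖hat e *ᵥ (J *ᵥ w)‖ ≤ 3 * ‖e‖ * ‖J *ᵥ w‖ := norm_hat_mulVec_le _ _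
      _ ≤ 3 * ‖e‖ * (3 * ‖J‖ * Ω) := by gcongr
      _ = _ := by ring
  have hh : ‖(Q * hat w) *ᵥ (J *ᵥ e)
      - Q *ᵥ (Kω *ᵥ e + hat e *ᵥ (J *ᵥ e) + hat e *ᵥ (J *ᵥ w))‖ ≤ c₁ * ‖e‖ := by
    calc _ ≤ ‖(Q * hat w) *ᵥ (J *ᵥ e)‖
          + ‖Q *ᵥ (Kω *ᵥ e + hat e *ᵥ (J *ᵥ e) + hat e *ᵥ (J *ᵥ w))‖ := norm_sub_le _ _
      _ ≤ 27 * ‖J‖ * Ω * ‖e‖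
          + 3 * (3 * ‖Kω‖ * ‖e‖ + 9 * ‖J‖ * r * ‖e‖ + 9 * ‖J‖ * Ω * ‖e‖) := by
        refine add_le_add hdrift ((norm_SO3_mulVec_le hQ _).trans ?_)
        gcongr
        exact norm_add₃_le.trans
          (add_le_add (add_le_add (norm_mulVec_le_mat3 Kω e) hgyro) hgyro')
      _ = c₁ * ‖e‖ := by rw [hc₁]; ring
  have hrate : ‖attErr KR (R * hat (Q *ᵥ e))‖ ≤ 27 * ‖KR‖ * ‖e‖ := by
    calc _ ≤ 3 * ‖KR‖ * ‖R * hat (Q *ᵥ e)‖ := norm_attErr_le _ _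
      _ ≤ 3 * ‖KR‖ * (3 * 1 * (3 * ‖e‖)) := by
        gcongr
        refine (norm_mul_le_mat3 _ _).trans ?_
        gcongr
        · exact norm_le_one_of_mem_SO3 hR
        · exact (norm_hat_le _).trans (norm_SO3_mulVec_le hQ e)
      _ = _ := by ring
  have h₁ := (le_abs_self _).trans (abs_dotProduct_le_vec3 (attErr KR R)
    ((Q * hat w) *ᵥ (J *ᵥ e) - Q *ᵥ (Kω *ᵥ e + hat e *ᵥ (J *ᵥ e) + hat e *ᵥ (J *ᵥ w))))
  have h₁' : 3 * ‖attErr KR R‖ * ‖(Q * hat w) *ᵥ (J *ᵥ e)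
      - Q *ᵥ (Kω *ᵥ e + hat e *ᵥ (J *ᵥ e) + hat e *ᵥ (J *ᵥ w))‖
      ≤ 3 * ‖attErr KR R‖ * (c₁ * ‖e‖) := by gcongr
  have h₂ : attErr KR (R * hat (Q *ᵥ e)) ⬝ᵥ Q *ᵥ (J *ᵥ e) ≤ c₂ * ‖e‖ ^ 2 := by
    calc _ ≤ 3 * ‖attErr KR (R * hat (Q *ᵥ e))‖ * ‖Q *ᵥ (J *ᵥ e)‖ :=
          (le_abs_self _).trans (abs_dotProduct_le_vec3 _ _)
      _ ≤ 3 * (27 * ‖KR‖ * ‖e‖) * (9 * ‖J‖ * ‖e‖) := by gcongr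
      _ = c₂ * ‖e‖ ^ 2 := by rw [hc₂]; ring
  have h₃ := sq_norm_le_dotProduct (attErr KR R)
  -- Young's inequality absorbs the mixed term into half of $\|e_R\|^2$ at the price of `9 / 2 * c₁
  -- ^ 2`.
  have hyoung := sq_nonneg (‖attErr KR R‖ - 3 * (c₁ * ‖e‖))
  nlinarith

theorem abs_crossTerm_le (J KR : Mat3) {Rp : ℝ → Mat3} {t : ℝ} (hRp : Rp t ∈ SO3)
    {x : Mat3 × Vec3} (hx : x ∈ TSO3) :
    |crossTerm J KR Rp t x| ≤ 81 * ‖KR‖ * ‖J‖ * ‖x.2‖ := by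
  calc _ ≤ 3 * ‖attErr KR x.1‖ * ‖Rp t *ᵥ (J *ᵥ x.2)‖ := abs_dotProduct_le_vec3 _ _
    _ ≤ 3 * (3 * ‖KR‖ * 1) * (3 * (3 * ‖J‖ * ‖x.2‖)) := by
      gcongr
      · refine (norm_attErr_le _ _).trans ?_
        gcongr
        exact norm_le_one_of_mem_SO3 hx
      · refine (norm_SO3_mulVec_le hRp _).trans ?_
        gcongr
        exact norm_mulVec_le_mat3 _ _
    _ = _ := by ring

end Estimates

/-! ### Compactness of energy sublevels and positivity on them -/

section Sublevel

attribute [local instance] Matrix.normedAddCommGroup Matrix.normedSpace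

theorem continuous_attErr (K : Mat3) : Continuous (attErr K) := by
  unfold attErr vee skewPart
  fun_prop

theorem continuous_navFun (K : Mat3) : Continuous (navFun K) := by
  unfold navFun
  fun_prop

theorem continuous_energyR (J KR : Mat3) : Continuous (energyR J KR) := by
  unfold energyR
  exact (continuous_const.mul (continuous_snd.dotProduct
    (continuous_const.matrix_mulVec continuous_snd))).add
    ((continuous_navFun KR).comp continuous_fst)

theorem isClosed_TSO3 : IsClosed TSO3 := by
  have : TSO3 = {x : Mat3 × Vec3 | x.1 * x.1ᵀ = 1} ∩ {x : Mat3 × Vec3 | x.1.det = 1} := by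
    ext x
    exact mem_SO3_iff
  rw [this]
  exact (isClosed_eq (by fun_prop) continuous_const).inter
    (isClosed_eq (by fun_prop) continuous_const)

/-- The part of the state space of energy at most `c`. -/
def energySublevel (J KR : Mat3) (c : ℝ) : Set (Mat3 × Vec3) :=
  {x | x ∈ TSO3 ∧ energyR J KR x ≤ c}

theorem energyR_nonneg {J KR : Mat3} (hJ : J.PosDef) (hKR : KR.IsSymm)
    (hKR' : (KR.trace • (1 : Mat3) - KR).PosDef)
    {x : Mat3 × Vec3} (hx : x ∈ TSO3) : 0 ≤ energyR J KR x := by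
  have h1 := hJ.posSemidef.dotProduct_mulVec_nonneg x.2
  have h2 := navFun_nonneg hKR hKR' hx
  simp only [star_trivial] at h1
  unfold energyR
  linarith

theorem eq_of_energyR_eq_zero {J KR : Mat3} (hJ : J.PosDef) (hKR : KR.IsSymm)
    (hKR' : (KR.trace • (1 : Mat3) - KR).PosDef)
    {x : Mat3 × Vec3} (hx : x ∈ TSO3) (h0 : energyR J KR x = 0) :
    x = (1, 0) := by
  have h1 := hJ.posSemidef.dotProduct_mulVec_nonneg x.2
  have h2 := navFun_nonneg hKR hKR' hx
  simp only [star_trivial] at h1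
  unfold energyR at h0
  refine Prod.ext (eq_one_of_navFun_eq_zero hKR hKR' hx (by linarith)) ?_
  by_contra he
  have := hJ.dotProduct_mulVec_pos he
  simp only [star_trivial] at this
  linarith

theorem sq_norm_angularVelocity_le {J KR : Mat3} (hJ : J.PosDef) (hKR : KR.IsSymm)
    (hKR' : (KR.trace • (1 : Mat3) - KR).PosDef)
    {c : ℝ} {x : Mat3 × Vec3} (hx : x ∈ energySublevel J KR c) :
    ‖x.2‖ ^ 2 ≤ 2 * c / lambdaMin J := by
  have hpos := lambdaMin_pos hJ
  have h1 := lambdaMin_mul_dotProduct_le hJ.isHermitian x.2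
  have h2 := navFun_nonneg hKR hKR' hx.1
  have h3 := hx.2
  unfold energyR at h3
  rw [le_div_iff₀ hpos]
  nlinarith [sq_norm_le_dotProduct x.2]

theorem norm_angularVelocity_le {J KR : Mat3} (hJ : J.PosDef) (hKR : KR.IsSymm)
    (hKR' : (KR.trace • (1 : Mat3) - KR).PosDef)
    {c : ℝ} {x : Mat3 × Vec3} (hx : x ∈ energySublevel J KR c) :
    ‖x.2‖ ≤ √(2 * c / lambdaMin J) :=
  Real.le_sqrt_of_sq_le (sq_norm_angularVelocity_le hJ hKR hKR' hx)

theorem isCompact_energySublevel {J KR : Mat3} (hJ : J.PosDef) (hKR : KR.IsSymm)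
    (hKR' : (KR.trace • (1 : Mat3) - KR).PosDef)
    (c : ℝ) : IsCompact (energySublevel J KR c) := by
  refine Metric.isCompact_of_isClosed_isBounded
    (isClosed_TSO3.inter (isClosed_le (continuous_energyR J KR) continuous_const)) ?_
  refine (Metric.isBounded_closedBall (x := (0 : Mat3 × Vec3))
    (r := max 1 (√(2 * c / lambdaMin J)))).subset fun x hx => ?_
  rw [mem_closedBall_zero_iff, Prod.norm_def]
  exact max_le_max (norm_le_one_of_mem_SO3 hx.1) (norm_angularVelocity_le hJ hKR hKR' hx)

/-- States of small energy are close to the equilibrium. -/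
theorem exists_energyR_lt_imp_mem {J KR : Mat3} (hJ : J.PosDef) (hKR : KR.IsSymm)
    (hKR' : (KR.trace • (1 : Mat3) - KR).PosDef)
    {U : Set (Mat3 × Vec3)}
    (hU : U ∈ 𝓝 ((1 : Mat3), (0 : Vec3))) :
    ∃ δ > 0, ∀ x ∈ TSO3, energyR J KR x < δ → x ∈ U := by
  have hcpt : IsCompact (energySublevel J KR 1 \ interior U) :=
    (isCompact_energySublevel hJ hKR hKR' 1).diff isOpen_interior
  rcases (energySublevel J KR 1 \ interior U).eq_empty_or_nonempty with hempty | hne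
  · refine ⟨1, one_pos, fun x hx hlt => ?_⟩
    by_contra hxU
    exact (hempty ▸ (⟨⟨hx, hlt.le⟩, fun h => hxU (interior_subset h)⟩ :
      x ∈ energySublevel J KR 1 \ interior U) : x ∈ (∅ : Set (Mat3 × Vec3)))
  · obtain ⟨y, hy, hmin⟩ := hcpt.exists_isMinOn hne (continuous_energyR J KR).continuousOn
    have hypos : 0 < energyR J KR y := by
      refine (energyR_nonneg hJ hKR hKR' hy.1.1).lt_of_ne' fun h0 => hy.2 ?_
      rw [eq_of_energyR_eq_zero hJ hKR hKR' hy.1.1 h0]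
      exact mem_interior_iff_mem_nhds.2 hU
    refine ⟨min 1 (energyR J KR y), lt_min one_pos hypos, fun x hx hlt => ?_⟩
    by_contra hxU
    exact absurd (hlt.trans_le (min_le_right _ _)) (not_lt.2 (hmin
      ⟨⟨hx, (hlt.trans_le (min_le_left _ _)).le⟩, fun h => hxU (interior_subset h)⟩))

/-- Below the critical level, the dissipation is bounded away from zero away from the
equilibrium. -/
theorem exists_pos_le_dissipation {J KR : Mat3} (hJ : J.PosDef) (hKR : KR.IsSymm)
    (hKR' : (KR.trace • (1 : Mat3) - KR).PosDef)
    {c δ : ℝ} (hc : c < levelR KR) (hδ : 0 < δ) :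
    ∃ μ > 0, ∀ x ∈ energySublevel J KR c, δ ≤ energyR J KR x →
      μ ≤ ‖x.2‖ ^ 2 + ‖attErr KR x.1‖ ^ 2 := by
  have hcpt : IsCompact (energySublevel J KR c ∩ {x | δ ≤ energyR J KR x}) :=
    (isCompact_energySublevel hJ hKR hKR' c).inter_right
      (isClosed_le continuous_const (continuous_energyR J KR))
  have hcont : Continuous fun x : Mat3 × Vec3 => ‖x.2‖ ^ 2 + ‖attErr KR x.1‖ ^ 2 :=
    (continuous_snd.norm.pow 2).add (((continuous_attErr KR).comp continuous_fst).norm.pow 2)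
  rcases (energySublevel J KR c ∩ {x | δ ≤ energyR J KR x}).eq_empty_or_nonempty with he | hne
  · exact ⟨1, one_pos, fun x hx hδx => ((eq_empty_iff_forall_notMem.1 he) x ⟨hx, hδx⟩).elim⟩
  · obtain ⟨y, hy, hmin⟩ := hcpt.exists_isMinOn hne hcont.continuousOn
    refine ⟨_, ?_, fun x hx hδx => hmin ⟨hx, hδx⟩⟩
    -- A nonpositive minimum forces $e_\omega=0$ and $e_R=0$; below the critical level the state is
    -- then the equilibrium, of energy $0<\delta$.
    by_contra hle
    have h1 := sq_nonneg ‖y.2‖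
    have h2 := sq_nonneg ‖attErr KR y.1‖
    have hy2 : y.2 = 0 := norm_eq_zero.1 (pow_eq_zero_iff two_ne_zero |>.1 (by linarith))
    have herr : attErr KR y.1 = 0 :=
      norm_eq_zero.1 (pow_eq_zero_iff two_ne_zero |>.1 (by linarith))
    have hE : energyR J KR y = navFun KR y.1 := by simp [energyR, hy2]
    have hy1 := eq_one_of_attErr_eq_zero hKR hKR' hy.1.1 (hE ▸ hy.1.2.trans_lt hc) herr
    have : energyR J KR y = 0 := by rw [hE, hy1]; simp [navFun]
    have hyδ : δ ≤ energyR J KR y := hy.2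
    linarith

end Sublevel

/-! ### Invariance, completeness and uniform convergence -/

section Trajectories

attribute [local instance] Matrix.normedAddCommGroup Matrix.normedSpace

variable {J KR Kω : Mat3} {Rp : ℝ → Mat3} {ωp : ℝ → Vec3}

/-- Rotations are preserved by `Ṙ = R S` with `S` skew-symmetric. -/
theorem mem_SO3_of_hasDerivWithinAt {R : ℝ → Mat3} {S : ℝ → Mat3} {a b : ℝ} (ha : R a ∈ SO3)
    (hS : ∀ t ∈ Icc a b, (S t)ᵀ = -S t)
    (hR : ∀ t ∈ Icc a b, HasDerivWithinAt R (R t * S t) (Icc a b) t) :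
    ∀ t ∈ Icc a b, R t ∈ SO3 := by
  have hder : ∀ t ∈ Icc a b, HasDerivWithinAt (fun τ => R τ * (R τ)ᵀ) 0 (Icc a b) t := by
    intro t ht
    refine ((hR t ht).mat3_mul (hR t ht).mat3_transpose).congr_deriv ?_
    rw [Matrix.transpose_mul, hS t ht, Matrix.neg_mul, Matrix.mul_neg, Matrix.mul_assoc,
      add_neg_cancel]
  have horth : ∀ t ∈ Icc a b, R t * (R t)ᵀ = 1 := by
    intro t ht
    rw [← SO3.mul_transpose ha]
    exact constant_of_has_deriv_right_zero (fun t ht => (hder t ht).continuousWithinAt)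
      (fun t ht => (hder t (Ico_subset_Icc_self ht)).Ici_of_Icc ht) t ht
  have hcont : ContinuousOn (fun t => (R t).det) (Icc a b) :=
    (Continuous.matrix_det continuous_id).comp_continuousOn
      fun t ht => (hR t ht).continuousWithinAt
  have hsq : ∀ t ∈ Icc a b, (R t).det = 1 ∨ (R t).det = -1 := by
    intro t ht
    have := congrArg Matrix.det (horth t ht)
    rw [Matrix.det_mul, Matrix.det_transpose, Matrix.det_one] at this
    exact mul_self_eq_one_iff.1 this
  intro t ht
  refine mem_SO3_iff.2 ⟨horth t ht, (hsq t ht).resolve_right fun hneg => ?_⟩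
  -- Orthogonality allows only determinants ±1, so a continuous change of sign is impossible.
  have hzero : (0 : ℝ) ∈ (fun t => (R t).det) '' Icc a t := by
    refine intermediate_value_Icc' ht.1 (hcont.mono (Icc_subset_Icc_right ht.2)) ?_
    simp [hneg, SO3.det ha]
  obtain ⟨s, hs, hs0⟩ := hzero
  rcases hsq s ⟨hs.1, hs.2.trans ht.2⟩ with h | h <;> simp only [h] at hs0 <;> norm_num at hs0

/-- The energy does not increase along rescaled solutions. -/
theorem antitoneOn_energyR (hJ : J.PosDef) (hKω : Kω.PosDef) {s : Set ℝ} (hs : Convex ℝ s)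
    (hRp : ∀ t ∈ s, Rp t ∈ SO3) {φ : ℝ → ℝ} (hφ : ∀ t, 0 ≤ φ t) {x : ℝ → Mat3 × Vec3}
    (hx : ∀ t ∈ s, HasDerivWithinAt x (φ t • attErrField J KR Kω Rp ωp t (x t)) s t) :
    AntitoneOn (fun t => energyR J KR (x t)) s := by
  have hder := fun t ht => hasDerivWithinAt_energyR hJ (hRp t ht) (hx t ht)
  refine antitoneOn_of_hasDerivWithinAt_nonpos hs (fun t ht => (hder t ht).continuousWithinAt)
    (fun t ht => (hder t (interior_subset ht)).mono interior_subset) fun t _ => ?_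
  have := hKω.posSemidef.dotProduct_mulVec_nonneg (x t).2
  simp only [star_trivial] at this
  exact neg_nonpos.2 (mul_nonneg (hφ t) this)

/-- A factor `φ ≥ 0` changes neither the skew-symmetry behind invariance of SO(3) nor the sign of
the dissipation. -/
theorem trapsRescaled_energySublevel (hJ : J.PosDef) (hKω : Kω.PosDef)
    (href : IsFeasibleReference Rp ωp) {t₀ : ℝ} (ht₀ : 0 ≤ t₀) {x₀ : Mat3 × Vec3}
    (hx₀ : x₀ ∈ TSO3) :
    TrapsRescaled (attErrField J KR Kω Rp ωp) (energySublevel J KR (energyR J KR x₀)) t₀ x₀ := by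
  intro φ hφ T x hxt₀ hx t ht
  have hRp : ∀ t ∈ Icc t₀ T, Rp t ∈ SO3 := fun t ht => href.mem t (ht₀.trans ht.1)
  refine ⟨?_, ?_⟩
  · refine mem_SO3_of_hasDerivWithinAt (R := fun τ => (x τ).1)
      (S := fun τ => φ (x τ) • hat (Rp τ *ᵥ (x τ).2)) (b := T) (hxt₀ ▸ hx₀)
      (fun τ _ => ?_) (fun τ hτ => ?_) t ht
    · rw [Matrix.transpose_smul, transpose_hat, smul_neg]
    · refine (hx τ hτ).prod_fst.congr_deriv ?_
      rw [← SO3.mul_hat_mul_transpose (hRp τ hτ)]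
      simp [attErrField, Matrix.mul_assoc]
  · have := antitoneOn_energyR (KR := KR) hJ hKω (convex_Icc t₀ T) hRp (fun t => hφ (x t)) hx
      (left_mem_Icc.2 (ht.1.trans ht.2)) ht ht.1
    simpa [hxt₀] using this

/-- The error dynamics as a smooth function of the reference and of the state. -/
noncomputable def attErrModel (J KR Kω : Mat3) (q : (Mat3 × Vec3) × (Mat3 × Vec3)) :
    Mat3 × Vec3 :=
  attErrField J KR Kω (fun _ => q.1.1) (fun _ => q.1.2) 0 q.2

theorem contDiff_attErrModel (J KR Kω : Mat3) : ContDiff ℝ 1 (attErrModel J KR Kω) := by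
  have hentry : ∀ i j, ContDiff ℝ 1 fun A : Mat3 => A i j := fun i j =>
    (contDiff_apply_apply ℝ ℝ i j : ContDiff ℝ 1 fun A : Fin 3 → Fin 3 → ℝ => A i j)
  have hQ : ∀ i j, ContDiff ℝ 1 fun q : (Mat3 × Vec3) × (Mat3 × Vec3) => q.1.1 i j :=
    fun i j => (hentry i j).comp (contDiff_fst.comp contDiff_fst)
  have hR : ∀ i j, ContDiff ℝ 1 fun q : (Mat3 × Vec3) × (Mat3 × Vec3) => q.2.1 i j :=
    fun i j => (hentry i j).comp (contDiff_fst.comp contDiff_snd)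
  have hw : ∀ i, ContDiff ℝ 1 fun q : (Mat3 × Vec3) × (Mat3 × Vec3) => q.1.2 i := fun i =>
    (contDiff_apply ℝ ℝ i).comp (contDiff_snd.comp contDiff_fst)
  have he : ∀ i, ContDiff ℝ 1 fun q : (Mat3 × Vec3) × (Mat3 × Vec3) => q.2.2 i := fun i =>
    (contDiff_apply ℝ ℝ i).comp (contDiff_snd.comp contDiff_snd)
  have hhat : ∀ i j, ContDiff ℝ 1 fun q : (Mat3 × Vec3) × (Mat3 × Vec3) => hat q.2.2 i j := by
    intro i j
    fin_cases i <;> fin_cases j <;> simp only [hat] <;> simp <;> fun_prop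
  have herr : ∀ i, ContDiff ℝ 1 fun q : (Mat3 × Vec3) × (Mat3 × Vec3) => attErr KR q.2.1 i := by
    intro i
    fin_cases i <;>
      simp [attErr, vee, skewPart, Matrix.mul_apply, -Matrix.transpose_mul] <;> fun_prop
  refine ContDiff.prodMk ?_ ?_
  · refine contDiff_pi.2 fun i => contDiff_pi.2 fun j => ?_
    simp only [Matrix.mul_apply, Matrix.transpose_apply]
    fun_prop
  · refine contDiff_pi.2 fun i => ?_
    simp only [Matrix.mulVec, dotProduct, Pi.sub_apply, Pi.neg_apply, Matrix.transpose_apply]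
    fun_prop

theorem forwardComplete_attErrField (hJ : J.PosDef) (hKR : KR.IsSymm)
    (hKR' : (KR.trace • (1 : Mat3) - KR).PosDef) (hKω : Kω.PosDef)
    (href : IsFeasibleReference Rp ωp) {t₀ : ℝ} (ht₀ : 0 ≤ t₀) {x₀ : Mat3 × Vec3}
    (hx₀ : x₀ ∈ TSO3) : ForwardComplete TSO3 (attErrField J KR Kω Rp ωp) t₀ x₀ := by
  obtain ⟨C, hC⟩ := href.bounded
  have hsub : Ici t₀ ⊆ Ici (0 : ℝ) := Ici_subset_Ici.2 ht₀
  refine TrapsRescaled.forwardComplete (g := attErrModel J KR Kω) (p := fun t => (Rp t, ωp t))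
    (ρ := max 1 C) (contDiff_attErrModel J KR Kω) ?_ (fun t ht => ?_)
    (isCompact_energySublevel hJ hKR hKR' _).isBounded (fun x hx => hx.1)
    (trapsRescaled_energySublevel hJ hKω href ht₀ hx₀)
  · exact ContinuousOn.prodMk
      (fun t ht => ((href.kinematics t (hsub ht)).continuousWithinAt).mono hsub)
      (href.smooth.continuousOn.mono hsub)
  · rw [mem_closedBall_zero_iff, Prod.norm_def]
    exact max_le_max (norm_le_one_of_mem_SO3 (href.mem t (hsub ht))) (hC t (hsub ht))

theorem antitoneOn_energyR_of_isSolutionOn (hJ : J.PosDef) (hKω : Kω.PosDef)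
    (href : IsFeasibleReference Rp ωp) {t₀ : ℝ} (ht₀ : 0 ≤ t₀) {x : ℝ → Mat3 × Vec3}
    (hx : IsSolutionOn TSO3 (attErrField J KR Kω Rp ωp) (Ici t₀) x) :
    AntitoneOn (fun t => energyR J KR (x t)) (Ici t₀) :=
  antitoneOn_energyR hJ hKω (convex_Ici t₀) (fun t ht => href.mem t (ht₀.trans ht))
    (φ := fun _ => 1) (fun _ => zero_le_one) fun t ht => by simpa using (hx t ht).2

/-- Uniform convergence from a sublevel set below the critical level. -/
theorem exists_time_forall_mem (hJ : J.PosDef) (hKR : KR.IsSymm)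
    (hKR' : (KR.trace • (1 : Mat3) - KR).PosDef) (hKω : Kω.PosDef)
    (href : IsFeasibleReference Rp ωp) {c : ℝ} (hc : c < levelR KR) {U : Set (Mat3 × Vec3)}
    (hU : U ∈ 𝓝 ((1 : Mat3), (0 : Vec3))) :
    ∃ T : ℝ, 0 ≤ T ∧ ∀ t₀ : ℝ, 0 ≤ t₀ → ∀ x : ℝ → Mat3 × Vec3,
      IsSolutionOn TSO3 (attErrField J KR Kω Rp ωp) (Ici t₀) x → energyR J KR (x t₀) ≤ c →
      ∀ t : ℝ, t₀ + T ≤ t → x t ∈ U := by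
  obtain ⟨Ω, hΩ⟩ := href.bounded
  have hΩ0 : 0 ≤ Ω := (norm_nonneg _).trans (hΩ 0 le_rfl)
  set r := √(2 * c / lambdaMin J)
  have hr0 : 0 ≤ r := Real.sqrt_nonneg _
  obtain ⟨b, hb0, hb⟩ := exists_crossTerm_deriv_le J KR Kω Ω r hΩ0 hr0
  obtain ⟨δ, hδ, hδU⟩ := exists_energyR_lt_imp_mem hJ hKR hKR' hU
  obtain ⟨μ, hμ, hμle⟩ := exists_pos_le_dissipation hJ hKR hKR' hc hδ
  have hk := lambdaMin_pos hKω
  set k := lambdaMin Kω with hk_def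
  -- Small enough that the bad term of $\varepsilon\dot W$ uses at most half of the dissipation; the
  -- `+ 1` covers `b = 0`.
  set ε : ℝ := k / (2 * (b + 1)) with hε_def
  have hε : 0 < ε := by positivity
  have hεb : ε * b ≤ k / 2 := by
    have : ε * (b + 1) = k / 2 := by rw [hε_def]; field_simp
    nlinarith
  set κ : ℝ := min (k / 2) (ε / 2)
  have hκ : 0 < κ := lt_min (by positivity) (by positivity)
  set B : ℝ := 81 * ‖KR‖ * ‖J‖ * r
  have hB : 0 ≤ B := by positivity
  -- Decay at rate `κ * μ` for this long exceeds the initial energy plus twice the largest cross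
  -- term; `+ 1` makes the contradiction strict.
  set T : ℝ := (|c| + 2 * ε * B + 1) / (κ * μ) with hT
  have hκμ : 0 < κ * μ := mul_pos hκ hμ
  have hTmul : κ * μ * T = |c| + 2 * ε * B + 1 := by rw [hT]; field_simp
  have hT0 : 0 ≤ T := by positivity
  refine ⟨T, hT0, fun t₀ ht₀ x hx hxc t ht => ?_⟩
  have hanti := antitoneOn_energyR_of_isSolutionOn hJ hKω href ht₀ hx
  have hsub : ∀ s ∈ Ici t₀, x s ∈ energySublevel J KR c := fun s hs =>
    ⟨(hx s hs).1, (hanti self_mem_Ici hs hs).trans hxc⟩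
  -- One such time suffices, since the energy never increases. Otherwise $V_R+\varepsilon
  -- W+\kappa\mu\tau$ is nonincreasing on the whole interval and the final energy would be negative.
  obtain ⟨s, hs, hsδ⟩ : ∃ s ∈ Icc t₀ (t₀ + T), energyR J KR (x s) < δ := by
    by_contra! hge
    have hder : ∀ s ∈ Icc t₀ (t₀ + T), ∃ d ≤ 0, HasDerivWithinAt
        (fun τ => energyR J KR (x τ) + ε * crossTerm J KR Rp τ (x τ) + κ * μ * τ) d
        (Icc t₀ (t₀ + T)) s := by
      intro s hs
      have hss : Icc t₀ (t₀ + T) ⊆ Ici t₀ := Icc_subset_Ici_self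
      have hs0 : 0 ≤ s := ht₀.trans hs.1
      have hxs := ((hx s (hss hs)).2).mono hss
      have hV := hasDerivWithinAt_energyR (φ := 1) hJ (href.mem s hs0)
        (hxs.congr_deriv (one_smul ℝ _).symm)
      have hW := hasDerivWithinAt_crossTerm hJ (href.mem s hs0)
        ((href.kinematics s hs0).mono (hss.trans (Ici_subset_Ici.2 ht₀))) hxs
      refine ⟨_, ?_, (hV.add (hW.const_mul ε)).add
        ((hasDerivWithinAt_id s _).const_mul (κ * μ))⟩
      have hWle := hb (Rp s) (href.mem s hs0) (x s).1 (hx s (hss hs)).1 (ωp s) (x s).2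
        (hΩ s hs0) (norm_angularVelocity_le hJ hKR hKR' (hsub s (hss hs)))
      have hVle := lambdaMin_mul_dotProduct_le hKω.isHermitian (x s).2
      have hsq := mul_le_mul_of_nonneg_left (sq_norm_le_dotProduct (x s).2) hk.le
      have hm := mul_le_mul_of_nonneg_left (hμle (x s) (hsub s (hss hs)) (hge s hs)) hκ.le
      have hκ1 := mul_le_mul_of_nonneg_right (min_le_left (k / 2) (ε / 2)) (sq_nonneg ‖(x s).2‖)
      have hκ2 := mul_le_mul_of_nonneg_right (min_le_right (k / 2) (ε / 2))
        (sq_nonneg ‖attErr KR (x s).1‖)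
      have hεW := mul_le_mul_of_nonneg_left hWle hε.le
      have hεb' := mul_le_mul_of_nonneg_right hεb (sq_nonneg ‖(x s).2‖)
      rw [← hk_def] at hVle
      linarith
    choose! d hd hder using hder
    have hmono := antitoneOn_of_hasDerivWithinAt_nonpos (convex_Icc t₀ (t₀ + T))
      (fun s hs => (hder s hs).continuousWithinAt)
      (fun s hs => (hder s (interior_subset hs)).mono interior_subset)
      (fun s hs => hd s (interior_subset hs))
      (left_mem_Icc.2 (by linarith)) (right_mem_Icc.2 (by linarith)) (by linarith : t₀ ≤ t₀ + T)
    have hbound : ∀ s ∈ Ici t₀, |crossTerm J KR Rp s (x s)| ≤ B := fun s hs =>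
      (abs_crossTerm_le J KR (href.mem s (ht₀.trans hs)) (hx s hs).1).trans
        (mul_le_mul_of_nonneg_left (norm_angularVelocity_le hJ hKR hKR' (hsub s hs)) (by positivity))
    have hend : t₀ + T ∈ Ici t₀ := by simpa using hT0
    have h1 := mul_le_mul_of_nonneg_left (abs_le.1 (hbound t₀ self_mem_Ici)).2 hε.le
    have h2 := mul_le_mul_of_nonneg_left (abs_le.1 (hbound _ hend)).1 hε.le
    have h3 := energyR_nonneg hJ hKR hKR' (hx _ hend).1
    have h4 := le_abs_self c
    simp only at hmono
    linarith
  have hts : s ≤ t := hs.2.trans ht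
  exact hδU _ (hx t (hs.1.trans hts)).1
    ((hanti hs.1 (hs.1.trans hts : t₀ ≤ t) hts).trans_lt hsδ)

theorem uniformlyAttracts_energyR_lt (hJ : J.PosDef) (hKR : KR.IsSymm)
    (hKR' : (KR.trace • (1 : Mat3) - KR).PosDef) (hKω : Kω.PosDef)
    (href : IsFeasibleReference Rp ωp) {c : ℝ} (hc : c < levelR KR) :
    UniformlyAttracts TSO3 (attErrField J KR Kω Rp ωp) ((1 : Mat3), (0 : Vec3))
      {x | energyR J KR x < c} := by
  refine ⟨fun t₀ ht₀ x₀ hx₀ => forwardComplete_attErrField hJ hKR hKR' hKω href ht₀ hx₀.2,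
    fun U hU => ?_⟩
  obtain ⟨T, hT0, hT⟩ := exists_time_forall_mem hJ hKR hKR' hKω href hc hU
  refine ⟨T, hT0, fun t₀ ht₀ x₀ hx₀ x hx hxt₀ => hT t₀ ht₀ x hx ?_⟩
  have hlt : energyR J KR x₀ < c := hx₀.1
  exact hxt₀ ▸ hlt.le

theorem sublevelA_subset_uniformBasin (hJ : J.PosDef) (hKR : KR.IsSymm)
    (hKR' : (KR.trace • (1 : Mat3) - KR).PosDef) (hKω : Kω.PosDef)
    (href : IsFeasibleReference Rp ωp) :
    sublevelA J KR ⊆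
      uniformBasin TSO3 (attErrField J KR Kω Rp ωp) ((1 : Mat3), (0 : Vec3)) := by
  intro x₀ hx₀
  -- The gap below $\ell_R$ leaves room for an open sublevel around `x₀`, which supplies the local
  -- uniformity.
  obtain ⟨c, hx₀c, hc⟩ := exists_between hx₀.2
  exact ⟨hx₀.1, {x | energyR J KR x < c},
    (isOpen_lt (continuous_energyR J KR) continuous_const).mem_nhds hx₀c,
    uniformlyAttracts_energyR_lt hJ hKR hKR' hKω href hc⟩

theorem energyR_equilibrium (J KR : Mat3) : energyR J KR (1, 0) = 0 := by
  simp [energyR, navFun]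

theorem isEquilibriumPoint_attErrField (hKR : KR.IsSymm) :
    IsEquilibriumPoint TSO3 (attErrField J KR Kω Rp ωp) ((1 : Mat3), (0 : Vec3)) := by
  have herr : attErr KR 1 = 0 := by
    have : skewPart (KR * 1) = 0 := by simp [skewPart, hKR.eq]
    rw [attErr, this]
    ext i; fin_cases i <;> simp [vee]
  refine ⟨mem_SO3_iff.2 (by simp), fun t _ => ?_⟩
  simp [attErrField, hat_zero, herr]

theorem uniformlyStable_attErrField (hJ : J.PosDef) (hKR : KR.IsSymm)
    (hKR' : (KR.trace • (1 : Mat3) - KR).PosDef) (hKω : Kω.PosDef)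
    (href : IsFeasibleReference Rp ωp) :
    UniformlyStable TSO3 (attErrField J KR Kω Rp ωp) ((1 : Mat3), (0 : Vec3)) := by
  intro U hU
  obtain ⟨δ, hδ, hδU⟩ := exists_energyR_lt_imp_mem hJ hKR hKR' hU
  refine ⟨{x | energyR J KR x < δ}, (isOpen_lt (continuous_energyR J KR)
    continuous_const).mem_nhds (by simpa [energyR_equilibrium] using hδ), fun t₀ ht₀ x₀ hx₀ =>
    ⟨forwardComplete_attErrField hJ hKR hKR' hKω href ht₀ hx₀.2, fun x hx hxt₀ t ht => ?_⟩⟩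
  refine hδU _ (hx t ht).1 (lt_of_le_of_lt
    (antitoneOn_energyR_of_isSolutionOn hJ hKω href ht₀ hx self_mem_Ici ht ht) ?_)
  simp only [hxt₀]
  exact hx₀.1

end Trajectories

theorem mainTheorem4 (J KR Kω : Mat3) (hJ : J.PosDef) (hKR : KR.IsSymm)
    (hKR' : (KR.trace • (1 : Mat3) - KR).PosDef) (hKω : Kω.PosDef)
    (Rp : ℝ → Mat3) (ωp : ℝ → Vec3) (href : IsFeasibleReference Rp ωp) :
    UniformlyAsymptoticallyStable TSO3 (attErrField J KR Kω Rp ωp) ((1 : Mat3), (0 : Vec3)) ∧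
    sublevelA J KR ⊆ uniformBasin TSO3 (attErrField J KR Kω Rp ωp) ((1 : Mat3), (0 : Vec3)) := by
  have hbasin := sublevelA_subset_uniformBasin hJ hKR hKR' hKω href
  have heq := isEquilibriumPoint_attErrField (J := J) (Kω := Kω) (Rp := Rp) (ωp := ωp) hKR
  -- Since $\ell_R>0$, the basin statement at the equilibrium itself yields the attracting
  -- neighbourhood.
  have hmem : ((1 : Mat3), (0 : Vec3)) ∈ sublevelA J KR :=
    ⟨heq.1, by rw [energyR_equilibrium]; exact lambdaMin_pos hKR'⟩
  exact ⟨⟨heq, uniformlyStable_attErrField hJ hKR hKR' hKω href, (hbasin hmem).2⟩, hbasin⟩
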